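/- For a metric space $(M,d)$ with a distinguished point $0\in M$, let $\operatorname{Lip}_0(M)$ be the real Banach space of all Lipschitz functions $f:M\to\mathbb{R}$ with $f(0)=0$, normed by the best Lipschitz constant $\|f\|=\sup_{x\neq y}\frac{|f(x)-f(y)|}{d(x,y)}$. Let $\ell_1$ be the Banach space of absolutely summable real sequences, with distinguished point the origin, and let $\mathbb{Z}^{<\mathbb{N}}$ be the subgroup of $\ell_1$ generated by the canonical basis vectors $e_n$, $n\in\mathbb{N}$, with the metric inherited from $\ell_1$ and the origin as distinguished point. Let $\bigoplus_{\ell_\infty}\operatorname{Lip}_0(\mathbb{Z}^{<\mathbb{N}})$ denote the Banach space of all bounded sequences $(f_n)_{n\in\mathbb{N}}$ in $\operatorname{Lip}_0(\mathbb{Z}^{<\mathbb{N}})$, with the norm $\sup_n\|f_n\|$. Then $$\bigoplus_{\ell_\infty}\operatorname{Lip}_0(\mathbb{Z}^{<\mathbb{N}})\simeq\operatorname{Lip}_0(\ell_1),$$ that is, there is a bounded linear bijection with bounded inverse between these two Banach spaces. -/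

import Mathlib

open scoped ENNReal NNReal

noncomputable section

/-- The vector space of all Lipschitz functions `f : M → ℝ` on the metric space `M` that vanish at
the distinguished point `o`, as a linear subspace of all functions `M → ℝ`. -/
def lip0Submodule (M : Type*) [MetricSpace M] (o : M) : Submodule ℝ (M → ℝ) where
  carrier := {f | f o = 0 ∧ ∃ K : ℝ≥0, LipschitzWith K f}
  zero_mem' := ⟨rfl, 0, LipschitzWith.const (0 : ℝ)⟩
  add_mem' := by
    rintro f g ⟨hf, K, hK⟩ ⟨hg, L, hL⟩
    exact ⟨by simp [hf, hg], K + L, hK.add hL⟩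
  smul_mem' := by
    rintro c f ⟨hf, K, hK⟩
    refine ⟨by simp [hf], ‖c‖₊ * K, ?_⟩
    exact (lipschitzWith_smul c).comp hK

/-- The space `Lip₀(M)` of all Lipschitz functions `f : M → ℝ` vanishing at the distinguished
point `o`. It is a type of its own, so that its topology is the one of the Lipschitz norm defined
below and not the topology of pointwise convergence inherited from `M → ℝ`. -/
def Lip0 (M : Type*) [MetricSpace M] (o : M) : Type _ := lip0Submodule M o

namespace Lip0

variable {M : Type*} [MetricSpace M] {o : M}

instance instAddCommGroup : AddCommGroup (Lip0 M o) :=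
  inferInstanceAs (AddCommGroup (lip0Submodule M o))

instance instModule : Module ℝ (Lip0 M o) :=
  inferInstanceAs (Module ℝ (lip0Submodule M o))

instance instFunLike : FunLike (Lip0 M o) M ℝ where
  coe f := f.1
  coe_injective _ _ h := Subtype.ext h

@[ext] theorem ext {f g : Lip0 M o} (h : ∀ x, f x = g x) : f = g := DFunLike.ext f g h

@[simp] theorem add_apply (f g : Lip0 M o) (x : M) : (f + g) x = f x + g x := rfl

@[simp] theorem smul_apply (c : ℝ) (f : Lip0 M o) (x : M) : (c • f) x = c * f x := rfl

@[simp] theorem zero_apply (x : M) : (0 : Lip0 M o) x = 0 := rfl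

@[simp] theorem map_base (f : Lip0 M o) : f o = 0 := f.2.1

/-- The norm of `Lip₀(M)` is the best Lipschitz constant,
`sup_{x ≠ y} |f x - f y| / d(x, y)`. (Pairs with `x = y` contribute `0 / 0 = 0`.) -/
instance instNorm : Norm (Lip0 M o) where
  norm f := ⨆ p : M × M, |f p.1 - f p.2| / dist p.1 p.2

theorem norm_def (f : Lip0 M o) :
    ‖f‖ = ⨆ p : M × M, |f p.1 - f p.2| / dist p.1 p.2 := rfl

theorem bddAbove_quot (f : Lip0 M o) :
    BddAbove (Set.range fun p : M × M => |f p.1 - f p.2| / dist p.1 p.2) := by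
  obtain ⟨-, K, hK⟩ := f.2
  refine ⟨K, ?_⟩
  rintro _ ⟨p, rfl⟩
  refine div_le_of_le_mul₀ dist_nonneg K.2 ?_
  have h := hK.dist_le_mul p.1 p.2
  rwa [Real.dist_eq] at h

theorem abs_sub_le (f : Lip0 M o) (x y : M) : |f x - f y| ≤ ‖f‖ * dist x y := by
  rcases eq_or_ne x y with rfl | h
  · simp
  · exact (div_le_iff₀ (dist_pos.2 h)).1 (le_ciSup (bddAbove_quot f) (x, y))

theorem norm_nonneg' (f : Lip0 M o) : 0 ≤ ‖f‖ :=
  Real.iSup_nonneg fun _ => div_nonneg (abs_nonneg _) dist_nonneg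

theorem norm_le_of {f : Lip0 M o} {C : ℝ} (hC : 0 ≤ C)
    (h : ∀ x y, |f x - f y| ≤ C * dist x y) : ‖f‖ ≤ C :=
  Real.iSup_le (fun p => div_le_of_le_mul₀ dist_nonneg hC (h p.1 p.2)) hC

theorem normCore : NormedSpace.Core ℝ (Lip0 M o) where
  norm_nonneg := norm_nonneg'
  norm_smul c f := by
    rw [norm_def, norm_def, Real.mul_iSup_of_nonneg (norm_nonneg c)]
    refine iSup_congr fun p => ?_
    rw [smul_apply, smul_apply, ← mul_sub, abs_mul, Real.norm_eq_abs, mul_div_assoc]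
  norm_triangle f g := by
    refine norm_le_of (add_nonneg (norm_nonneg' f) (norm_nonneg' g)) fun x y => ?_
    rw [add_apply, add_apply, add_sub_add_comm, add_mul]
    exact (abs_add_le _ _).trans (add_le_add (abs_sub_le f x y) (abs_sub_le g x y))
  norm_eq_zero_iff f := by
    constructor
    · intro h
      ext x
      have := abs_sub_le f x o
      rw [h, zero_mul, map_base, sub_zero] at this
      exact abs_nonpos_iff.1 this
    · rintro rfl
      exact le_antisymm (norm_le_of le_rfl fun x y => by simp) (norm_nonneg' _)

instance instNormedAddCommGroup : NormedAddCommGroup (Lip0 M o) :=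
  NormedAddCommGroup.ofCore normCore

instance instNormedSpace : NormedSpace ℝ (Lip0 M o) :=
  NormedSpace.ofCore normCore

end Lip0

/-- The Banach space `ℓ₁` of absolutely summable real sequences. -/
abbrev EllOne : Type := lp (fun _ : ℕ => ℝ) 1

/-- `ℤ^{<ℕ}`: the subgroup of `ℓ₁` generated by the unit vectors `e₀, e₁, e₂, …`. As a subtype of
`ℓ₁` it carries the inherited `ℓ₁`-metric. -/
def ZFin : AddSubgroup EllOne :=
  AddSubgroup.closure (Set.range fun n : ℕ => lp.single 1 n (1 : ℝ))

end

/-!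
Write `X = Lip₀(ℓ₁)` and `Y = ℓ∞(Lip₀(ℤ^{<ℕ}))`. Since `Y ≃ ℓ∞(Y)`, Pełczyński's decomposition
method (`BoundedSeq.nonempty_equiv_of_retracts`) reduces the isomorphism `X ≃ Y` to the facts that
`X` is complemented in `Y` and `Y` is complemented in `X`.

Both facts rest on a linear extension operator `Lip0.extend : Lip₀(ℤ^{<ℕ}) → Lip₀(ℓ₁)` of norm at
most one. It sends `f` to `x ↦ ∫₀¹ f(⌊x + u⌋) du`, where the floor is taken coordinatewise and the
same shift `u` is used in all coordinates; for `0 < u < 1` the sequence `⌊x + u⌋` has finite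
support because `x n → 0`. As `∫₀¹ |⌊a + u⌋ - ⌊b + u⌋| du = |a - b|` for real `a, b`, summing over
the coordinates shows that random rounding preserves the `ℓ₁`-distance on average
(`lintegral_enorm_roundZ_sub`), which gives the norm bound; and lattice points are rounded to
themselves.

*`X` is complemented in `Y`.* Restrict `f ∈ X` to the lattices `2⁻ⁿ ℤ^{<ℕ}`, each of them a dilated
copy of `ℤ^{<ℕ}`. In the other direction extend the functions on the lattices to `ℓ₁` and take the
pointwise limit along a free ultrafilter. The extensions of the restrictions of one function `f`
agree with `f` on finer and finer lattices and are uniformly Lipschitz, so they converge to `f`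
(`tendsto_extendDyadic_restrictDyadic`).

*`Y` is complemented in `X`.* Decompose `ℓ₁ = ℓ₁(ℓ₁)` by splitting the coordinates into infinitely
many infinite blocks. A bounded sequence `g` in `Lip₀(ℓ₁)` is glued to the function
`x ↦ ∑ g n (block n x)`, which is Lipschitz because the `ℓ₁`-distance is additive over the blocks
(`glue`). As `g n 0 = 0`, restricting it to the `n`-th summand gives back `g n`.
-/

noncomputable section

/-! ### Bounded sequences and the decomposition method -/

namespace BoundedSeq

theorem norm_apply_le {E : Type*} [NormedAddCommGroup E] (a : lp (fun _ : ℕ => E) ∞) (n : ℕ) :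
    ‖a n‖ ≤ ‖a‖ :=
  lp.norm_apply_le_norm ENNReal.top_ne_zero a n

variable {V E F : Type*} [NormedAddCommGroup V] [NormedSpace ℝ V]
  [NormedAddCommGroup E] [NormedSpace ℝ E] [NormedAddCommGroup F] [NormedSpace ℝ F]

variable (E) in
/-- The Banach space `ℓ∞(E)` of bounded sequences in `E`. -/
abbrev Linf : Type _ := lp (fun _ : ℕ => E) ∞

/-- The operator `V → ℓ∞(E)` whose coordinates are a uniformly bounded sequence of operators
`V → E`. -/
def ofFamily (T : ℕ → V →L[ℝ] E) (C : ℝ) (hC : 0 ≤ C) (h : ∀ n v, ‖T n v‖ ≤ C * ‖v‖) :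
    V →L[ℝ] Linf E :=
  LinearMap.mkContinuous
    { toFun := fun v => ⟨fun n => T n v, memℓp_infty ⟨C * ‖v‖, by rintro _ ⟨n, rfl⟩; exact h n v⟩⟩
      map_add' := fun v w => by ext n; exact map_add (T n) v w
      map_smul' := fun c v => by ext n; exact map_smul (T n) c v }
    C fun v => lp.norm_le_of_forall_le (mul_nonneg hC (norm_nonneg v)) fun n => h n v

@[simp] theorem ofFamily_apply (T : ℕ → V →L[ℝ] E) (C : ℝ) (hC : 0 ≤ C)
    (h : ∀ n v, ‖T n v‖ ≤ C * ‖v‖) (v : V) (n : ℕ) : ofFamily T C hC h v n = T n v := rfl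

variable (E) in
/-- The `n`-th coordinate, as an operator `ℓ∞(E) → E`. -/
abbrev coord (n : ℕ) : Linf E →L[ℝ] E := lp.evalCLM ℝ (fun _ : ℕ => E) ∞ n

@[simp] theorem coord_apply (n : ℕ) (a : Linf E) : coord E n a = a n := rfl

/-- Coordinatewise application of an operator. -/
def map (T : E →L[ℝ] F) : Linf E →L[ℝ] Linf F :=
  ofFamily (fun n => T ∘L coord E n) ‖T‖ (norm_nonneg T) fun n a =>
    (T.le_opNorm _).trans (by gcongr; exact norm_apply_le a n)

@[simp] theorem map_apply (T : E →L[ℝ] F) (a : Linf E) (n : ℕ) : map T a n = T (a n) := rfl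

/-- Coordinatewise application of an isomorphism. -/
def congr (e : E ≃L[ℝ] F) : Linf E ≃L[ℝ] Linf F :=
  ContinuousLinearEquiv.equivOfInverse (map e.toContinuousLinearMap)
    (map e.symm.toContinuousLinearMap)
    (fun a => by ext n; simp) (fun a => by ext n; simp)

variable (E F) in
/-- `ℓ∞(E × F) ≃ ℓ∞(E) × ℓ∞(F)`. -/
def prodEquiv : Linf (E × F) ≃L[ℝ] Linf E × Linf F :=
  ContinuousLinearEquiv.equivOfInverse
    ((map (ContinuousLinearMap.fst ℝ E F)).prod (map (ContinuousLinearMap.snd ℝ E F)))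
    (ofFamily (fun n => (coord E n).prodMap (coord F n)) 1 zero_le_one fun n a => by
      rw [one_mul]
      exact max_le_max (norm_apply_le a.1 n) (norm_apply_le a.2 n))
    (fun a => by ext n <;> simp) (fun a => by ext n <;> simp)

variable (E) in
/-- `E × ℓ∞(E) ≃ ℓ∞(E)`, prepending an entry. -/
def consEquiv : (E × Linf E) ≃L[ℝ] Linf E :=
  ContinuousLinearEquiv.equivOfInverse
    (ofFamily (fun n => Nat.casesOn n (ContinuousLinearMap.fst ℝ E (Linf E))
        fun m => coord E m ∘L ContinuousLinearMap.snd ℝ E (Linf E)) 1 zero_le_one fun n a => by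
      rw [one_mul]
      cases n with
      | zero => exact norm_fst_le a
      | succ m => exact (norm_apply_le a.2 m).trans (norm_snd_le a))
    ((coord E 0).prod (ofFamily (fun n => coord E (n + 1)) 1 zero_le_one fun n a => by
      rw [one_mul]; exact norm_apply_le a (n + 1)))
    (fun a => by ext n <;> simp) (fun a => by ext n; cases n <;> simp)

variable (E) in
/-- `ℓ∞(ℓ∞(E)) ≃ ℓ∞(E)`, along the pairing bijection `ℕ × ℕ ≃ ℕ`. -/
def uncurryEquiv : Linf (Linf E) ≃L[ℝ] Linf E :=
  ContinuousLinearEquiv.equivOfInverse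
    (ofFamily (fun n => coord E n.unpair.2 ∘L coord (Linf E) n.unpair.1) 1 zero_le_one fun n a => by
      rw [one_mul]
      exact (norm_apply_le (a n.unpair.1) n.unpair.2).trans (norm_apply_le a _))
    (ofFamily (fun i => ofFamily (fun j => coord E (Nat.pair i j)) 1 zero_le_one fun j a => by
        rw [one_mul]; exact norm_apply_le a _) 1 zero_le_one fun i a => by
      rw [one_mul]
      exact lp.norm_le_of_forall_le (norm_nonneg a) fun j => norm_apply_le a _)
    (fun a => by ext i j; simp) (fun a => by ext n; simp)

/-- Pełczyński's decomposition method: if `V` is complemented in `ℓ∞(E)` and `ℓ∞(E)` is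
complemented in `V`, then `ℓ∞(E) ≃ V`. With `Y = ℓ∞(E)`, both spaces are isomorphic
to `V × Y`. -/
theorem nonempty_equiv_of_retracts (i : V →L[ℝ] Linf E) (p : Linf E →L[ℝ] V)
    (hpi : Function.RightInverse i p) (j : Linf E →L[ℝ] V) (q : V →L[ℝ] Linf E)
    (hqj : Function.RightInverse j q) : Nonempty (Linf E ≃L[ℝ] V) := by
  have eY : Linf E ≃L[ℝ] V × p.ker := ContinuousLinearEquiv.equivOfRightInverse p i hpi
  have eV : V ≃L[ℝ] Linf E × q.ker := ContinuousLinearEquiv.equivOfRightInverse q j hqj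
  -- `Y ≃ ℓ∞(Y) ≃ ℓ∞(V) × ℓ∞(ker p)`, and `ℓ∞(V)` absorbs one more factor `V`.
  have e₁ : Linf E ≃L[ℝ] Linf V × Linf p.ker :=
    (uncurryEquiv E).symm.trans ((congr eY).trans (prodEquiv V p.ker))
  have e₂ : (V × Linf E) ≃L[ℝ] Linf E :=
    ((ContinuousLinearEquiv.refl ℝ V).prodCongr e₁).trans
      ((ContinuousLinearEquiv.prodAssoc ℝ V (Linf V) (Linf p.ker)).symm.trans
        (((consEquiv V).prodCongr (ContinuousLinearEquiv.refl ℝ (Linf p.ker))).trans e₁.symm))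
  -- `Y ≃ Y × Y`, hence `V ≃ Y × ker q` absorbs one more factor `Y`.
  have e₃ : (Linf E × Linf E) ≃L[ℝ] Linf E :=
    ((ContinuousLinearEquiv.refl ℝ (Linf E)).prodCongr (uncurryEquiv E).symm).trans
      ((consEquiv (Linf E)).trans (uncurryEquiv E))
  have e₄ : (V × Linf E) ≃L[ℝ] V :=
    (ContinuousLinearEquiv.prodComm ℝ V (Linf E)).trans
      (((ContinuousLinearEquiv.refl ℝ (Linf E)).prodCongr eV).trans
        ((ContinuousLinearEquiv.prodAssoc ℝ (Linf E) (Linf E) q.ker).symm.trans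
          ((e₃.prodCongr (ContinuousLinearEquiv.refl ℝ q.ker)).trans eV.symm)))
  exact ⟨e₂.symm.trans e₄⟩

end BoundedSeq

/-! ### Operators between Lipschitz spaces -/

namespace Lip0

variable {M N : Type*} [MetricSpace M] [MetricSpace N] {o : M} {o' : N}

theorem abs_apply_le (f : Lip0 M o) (x : M) : |f x| ≤ ‖f‖ * dist x o := by
  simpa using abs_sub_le f x o

/-- The element of `Lip₀(M)` given by a function with a Lipschitz bound. -/
def mk (f : M → ℝ) (C : ℝ) (h0 : f o = 0) (h : ∀ x y, |f x - f y| ≤ C * dist x y) : Lip0 M o :=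
  ⟨f, h0, C.toNNReal, LipschitzWith.of_dist_le_mul fun x y => (h x y).trans <| by
    gcongr
    exact Real.le_coe_toNNReal C⟩

/-- An operator into `Lip₀(M)` from its values at the points of `M`. -/
def mkOperator {V : Type*} [NormedAddCommGroup V] [NormedSpace ℝ V] (T : M → V →ₗ[ℝ] ℝ) (C : ℝ)
    (hC : 0 ≤ C) (h0 : ∀ v, T o v = 0) (h : ∀ v x y, |T x v - T y v| ≤ C * ‖v‖ * dist x y) :
    V →L[ℝ] Lip0 M o :=
  LinearMap.mkContinuous
    { toFun := fun v => mk (fun x => T x v) (C * ‖v‖) (h0 v) (h v)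
      map_add' := fun v w => by ext x; exact map_add (T x) v w
      map_smul' := fun c v => by ext x; exact map_smul (T x) c v }
    C fun v => norm_le_of (mul_nonneg hC (norm_nonneg v)) (h v)

theorem norm_mkOperator_le {V : Type*} [NormedAddCommGroup V] [NormedSpace ℝ V]
    (T : M → V →ₗ[ℝ] ℝ) (C : ℝ) (hC : 0 ≤ C) (h0 : ∀ v, T o v = 0)
    (h : ∀ v x y, |T x v - T y v| ≤ C * ‖v‖ * dist x y) (v : V) :
    ‖mkOperator T C hC h0 h v‖ ≤ C * ‖v‖ :=
  norm_le_of (mul_nonneg hC (norm_nonneg v)) (h v)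

/-- Evaluation at a point, as a linear functional on `Lip₀(M)`. -/
def eval (x : M) : Lip0 M o →ₗ[ℝ] ℝ where
  toFun f := f x
  map_add' _ _ := rfl
  map_smul' _ _ := rfl

@[simp] theorem eval_apply (x : M) (f : Lip0 M o) : eval x f = f x := rfl

/-- The operator `f ↦ c • (f ∘ g)`, for a base point preserving map `g` whose Lipschitz constant is
at most `|c|⁻¹`, so that the operator has norm at most one. -/
def scaledComp (g : M → N) (c : ℝ) (hg0 : g o = o')
    (hg : ∀ x y, |c| * dist (g x) (g y) ≤ dist x y) :
    Lip0 N o' →L[ℝ] Lip0 M o :=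
  mkOperator (fun x => c • eval (g x)) 1 zero_le_one (fun f => by simp [hg0]) fun f x y => by
    calc |c * f (g x) - c * f (g y)| = |c| * |f (g x) - f (g y)| := by rw [← mul_sub, abs_mul]
      _ ≤ |c| * (‖f‖ * dist (g x) (g y)) := by gcongr; exact abs_sub_le f _ _
      _ = ‖f‖ * (|c| * dist (g x) (g y)) := by ring
      _ ≤ ‖f‖ * dist x y := by gcongr; exact hg x y
      _ = 1 * ‖f‖ * dist x y := by ring

theorem norm_scaledComp_le (g : M → N) (c : ℝ) (hg0 : g o = o')
    (hg : ∀ x y, |c| * dist (g x) (g y) ≤ dist x y) (f : Lip0 N o') :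
    ‖scaledComp g c hg0 hg f‖ ≤ 1 * ‖f‖ :=
  norm_mkOperator_le ..

end Lip0

/-! ### Limits along an ultrafilter -/

section Ultralimit

open Filter Topology

/-- The limit of a real sequence along a fixed free ultrafilter on `ℕ`
(a junk value if that limit does not exist, which can only happen for unbounded sequences). -/
def ultralimit (a : ℕ → ℝ) : ℝ := limUnder (hyperfilter ℕ : Filter ℕ) a

theorem tendsto_ultralimit {a : ℕ → ℝ} {C : ℝ} (h : ∀ n, |a n| ≤ C) :
    Tendsto a (hyperfilter ℕ) (𝓝 (ultralimit a)) := by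
  have hmem : ∀ n, a n ∈ Set.Icc (-C) C := fun n => abs_le.1 (h n)
  obtain ⟨l, -, hl⟩ := isCompact_Icc.ultrafilter_le_nhds ((hyperfilter ℕ).map a)
    (by
      rw [le_principal_iff]
      exact Filter.mem_map.2 (Filter.univ_mem' hmem))
  exact tendsto_nhds_limUnder ⟨l, hl⟩

theorem abs_ultralimit_le {a : ℕ → ℝ} {C : ℝ} (h : ∀ n, |a n| ≤ C) : |ultralimit a| ≤ C :=
  le_of_tendsto (tendsto_ultralimit h).abs (Eventually.of_forall h)

theorem ultralimit_eq_of_tendsto {a : ℕ → ℝ} {l : ℝ} (h : Tendsto a atTop (𝓝 l)) :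
    ultralimit a = l :=
  (h.mono_left Nat.hyperfilter_le_atTop).limUnder_eq

/-- The pointwise limit of a bounded sequence in `Lip₀(M)` along a free ultrafilter. -/
def Lip0.ultralimit {M : Type*} [MetricSpace M] {o : M} :
    lp (fun _ : ℕ => Lip0 M o) ∞ →L[ℝ] Lip0 M o :=
  have bound (a : lp (fun _ : ℕ => Lip0 M o) ∞) (x : M) (n : ℕ) : |a n x| ≤ ‖a‖ * dist x o :=
    (Lip0.abs_apply_le (a n) x).trans (by gcongr; exact BoundedSeq.norm_apply_le a n)
  Lip0.mkOperator
    (fun x =>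
      { toFun := fun a => _root_.ultralimit fun n => a n x
        map_add' := fun a b => Filter.Tendsto.limUnder_eq
          ((tendsto_ultralimit (bound a x)).add (tendsto_ultralimit (bound b x)))
        map_smul' := fun c a => Filter.Tendsto.limUnder_eq
          ((tendsto_ultralimit (bound a x)).const_mul c) })
    1 zero_le_one
    (fun a => ultralimit_eq_of_tendsto (by simp))
    fun a x y => by
      rw [one_mul]
      have key : _root_.ultralimit (fun n => a n x - a n y) =
          _root_.ultralimit (fun n => a n x) - _root_.ultralimit (fun n => a n y) :=
        Filter.Tendsto.limUnder_eq
          ((tendsto_ultralimit (bound a x)).sub (tendsto_ultralimit (bound a y)))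
      refine key.symm ▸ abs_ultralimit_le fun n => (Lip0.abs_sub_le (a n) x y).trans ?_
      gcongr
      exact BoundedSeq.norm_apply_le a n

end Ultralimit

/-! ### Rounding with a random shift -/

section Rounding

open MeasureTheory Set

theorem intervalIntegrable_floor_add (a s t : ℝ) :
    IntervalIntegrable (fun u : ℝ => (⌊a + u⌋ : ℝ)) volume s t :=
  Monotone.intervalIntegrable fun u v h => by
    gcongr

/-- Rounding down `a + u`, with `u` uniform in `(0, 1)`, gives `a` on average. -/
theorem integral_floor_add (a : ℝ) : ∫ u in (0 : ℝ)..1, (⌊a + u⌋ : ℝ) = a := by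
  have hfract : ∫ u in (0 : ℝ)..1, Int.fract (a + u) = ∫ u in (0 : ℝ)..1, u := by
    rw [intervalIntegral.integral_comp_add_left (fun u => Int.fract u) a, add_zero,
      Function.Periodic.intervalIntegral_add_eq (fun x => Int.fract_add_one x) a 0, zero_add]
    refine intervalIntegral.integral_congr_ae ?_
    filter_upwards [Measure.ae_ne volume (1 : ℝ)] with u hu hmem
    rw [uIoc_of_le zero_le_one] at hmem
    exact Int.fract_eq_self.2 ⟨hmem.1.le, lt_of_le_of_ne hmem.2 hu⟩
  have hsum : ∫ u in (0 : ℝ)..1, (Int.fract (a + u) + ⌊a + u⌋) = ∫ u in (0 : ℝ)..1, (a + u) := by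
    simp only [Int.fract_add_floor]
  have hI : IntervalIntegrable (fun u : ℝ => Int.fract (a + u)) volume 0 1 := by
    have hlin : Continuous fun u : ℝ => a + u := by fun_prop
    exact (hlin.intervalIntegrable 0 1).sub (intervalIntegrable_floor_add a 0 1)
  rw [intervalIntegral.integral_add hI (intervalIntegrable_floor_add a 0 1),
    intervalIntegral.integral_add (by simp) (by simp), hfract] at hsum
  simp only [integral_id, intervalIntegral.integral_const] at hsum
  norm_num at hsum
  linarith

/-- Random rounding preserves distances on average: the two roundings are ordered like
`a` and `b`, so that the absolute value can be taken outside the integral. -/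
theorem lintegral_enorm_floor_sub (a b : ℝ) :
    ∫⁻ u in Ioo (0 : ℝ) 1, ‖(⌊a + u⌋ : ℝ) - ⌊b + u⌋‖ₑ = ‖a - b‖ₑ := by
  wlog hab : b ≤ a generalizing a b
  · rw [enorm_sub_rev a b, ← this b a (le_of_not_ge hab)]
    simp only [enorm_sub_rev]
  have hI := (intervalIntegrable_floor_add a 0 1).sub (intervalIntegrable_floor_add b 0 1)
  have hnn (u : ℝ) : 0 ≤ (⌊a + u⌋ : ℝ) - ⌊b + u⌋ := by
    rw [sub_nonneg]
    gcongr
  rw [Real.enorm_of_nonneg (sub_nonneg.2 hab)]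
  conv_rhs => rw [← integral_floor_add a, ← integral_floor_add b]
  rw [← intervalIntegral.integral_sub (intervalIntegrable_floor_add a 0 1)
    (intervalIntegrable_floor_add b 0 1), intervalIntegral.integral_of_le zero_le_one,
    ← restrict_Ioo_eq_restrict_Ioc, ofReal_integral_eq_lintegral_ofReal
      (by
        rw [restrict_Ioo_eq_restrict_Ioc]
        exact (intervalIntegrable_iff_integrableOn_Ioc_of_le zero_le_one).1 hI)
      (Filter.Eventually.of_forall hnn)]
  exact lintegral_congr fun u => Real.enorm_of_nonneg (hnn u)

/-- The uniform distribution on `(0, 1)`. -/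
def uniformMeasure : Measure (Ioo (0 : ℝ) 1) := volume.comap Subtype.val

instance isProbabilityMeasure_uniformMeasure : IsProbabilityMeasure uniformMeasure :=
  ⟨by
    rw [uniformMeasure, comap_subtype_coe_apply measurableSet_Ioo, image_univ,
      Subtype.range_coe, Real.volume_Ioo]
    simp⟩

theorem EllOne.hasSum_norm (x : EllOne) : HasSum (fun n => ‖x n‖) ‖x‖ := by
  simpa using lp.hasSum_norm (by simp) x

theorem EllOne.enorm_eq_tsum (x : EllOne) : ‖x‖ₑ = ∑' n, ‖x n‖ₑ := by
  rw [← ofReal_norm, ← x.hasSum_norm.tsum_eq, ENNReal.ofReal_tsum_of_nonneg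
    (fun _ => norm_nonneg _) x.hasSum_norm.summable]
  simp only [ofReal_norm]

/-- The integer sequence `∑ z n • e n` in `ℤ^{<ℕ}`. -/
def ZFin.ofFinsupp (z : ℕ →₀ ℤ) : ZFin :=
  ⟨z.sum fun n k => k • lp.single 1 n (1 : ℝ), sum_mem fun n _ =>
    ZFin.zsmul_mem (AddSubgroup.subset_closure ⟨n, rfl⟩) _⟩

theorem ZFin.ofFinsupp_apply (z : ℕ →₀ ℤ) (n : ℕ) :
    (ZFin.ofFinsupp z : EllOne) n = z n := by
  have : (ZFin.ofFinsupp z : EllOne) n =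
      ∑ m ∈ z.support, (z m • lp.single 1 m (1 : ℝ) : EllOne) n := by
    simp only [ofFinsupp, Finsupp.sum]
    rw [lp.coeFn_sum, Finset.sum_apply]
  rw [this, Finset.sum_eq_single n]
  · rw [← Int.cast_smul_eq_zsmul ℝ, lp.coeFn_smul, Pi.smul_apply, lp.single_apply_self]
    simp
  · intro m _ hmn
    rw [← Int.cast_smul_eq_zsmul ℝ, lp.coeFn_smul, Pi.smul_apply, lp.single_apply_ne _ _ _ hmn.symm]
    simp
  · intro hn
    rw [Finsupp.notMem_support_iff.1 hn, zero_smul]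
    rfl

theorem ZFin.exists_int (z : ZFin) (n : ℕ) : ∃ k : ℤ, (z : EllOne) n = k := by
  obtain ⟨z, hz⟩ := z
  change ∃ k : ℤ, z n = k
  induction hz using AddSubgroup.closure_induction with
  | mem x hx =>
    obtain ⟨m, rfl⟩ := hx
    rcases eq_or_ne n m with rfl | h
    · exact ⟨1, by simp⟩
    · exact ⟨0, by simp [h]⟩
  | zero => exact ⟨0, by simp⟩
  | add x y _ _ hx hy =>
    obtain ⟨k, hk⟩ := hx
    obtain ⟨l, hl⟩ := hy
    exact ⟨k + l, by simp_all⟩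
  | neg x _ hx =>
    obtain ⟨k, hk⟩ := hx
    exact ⟨-k, by simp_all⟩

theorem finite_support_floor_add (x : EllOne) {u : ℝ} (hu : u ∈ Ioo (0 : ℝ) 1) :
    (Function.support fun n => ⌊x n + u⌋).Finite := by
  have h := x.hasSum_norm.summable.tendsto_cofinite_zero.eventually_lt_const
    (lt_min hu.1 (sub_pos.2 hu.2))
  refine h.mono fun n hn => ?_
  rw [Real.norm_eq_abs, lt_min_iff] at hn
  refine Int.floor_eq_zero_iff.2 ?_
  have h₁ := neg_abs_le (x n)
  have h₂ := le_abs_self (x n)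
  constructor <;> linarith

/-- The coordinatewise rounding of `x ∈ ℓ₁` to an integer sequence after the shift by `u`; the same
`u` is used for all coordinates. -/
def roundShift (x : EllOne) (u : Ioo (0 : ℝ) 1) : ℕ →₀ ℤ :=
  Finsupp.ofSupportFinite (fun n => ⌊x n + u⌋) (finite_support_floor_add x u.2)

theorem measurable_roundShift (x : EllOne) :
    @Measurable _ _ _ ⊤ (roundShift x) := by
  let _ : MeasurableSpace (ℕ →₀ ℤ) := ⊤
  refine measurable_to_countable' fun z => ?_
  have : roundShift x ⁻¹' {z} = ⋂ n, {u : Ioo (0 : ℝ) 1 | ⌊x n + u⌋ = z n} := by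
    ext u
    simp only [mem_preimage, mem_singleton_iff, Finsupp.ext_iff, mem_iInter, mem_ofPred_eq]
    rfl
  rw [this]
  refine MeasurableSet.iInter fun n => ?_
  exact (measurable_subtype_coe.const_add (x n)).floor (measurableSet_singleton (z n))

/-- The random lattice point near `x ∈ ℓ₁`. -/
def roundZ (x : EllOne) (u : Ioo (0 : ℝ) 1) : ZFin := ZFin.ofFinsupp (roundShift x u)

theorem roundZ_apply (x : EllOne) (u : Ioo (0 : ℝ) 1) (n : ℕ) :
    (roundZ x u : EllOne) n = ⌊x n + u⌋ :=
  ZFin.ofFinsupp_apply _ n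

theorem roundZ_coe (z : ZFin) (u : Ioo (0 : ℝ) 1) : roundZ z u = z := by
  refine Subtype.ext (lp.ext (funext fun n => ?_))
  obtain ⟨k, hk⟩ := ZFin.exists_int z n
  rw [roundZ_apply, hk, Int.floor_intCast_add, Int.floor_eq_zero_iff.2 ⟨u.2.1.le, u.2.2⟩, add_zero]

theorem measurable_comp_roundZ (f : ZFin → ℝ) (x : EllOne) :
    Measurable fun u => f (roundZ x u) :=
  let _ : MeasurableSpace (ℕ →₀ ℤ) := ⊤
  (measurable_from_top (f := fun z => f (ZFin.ofFinsupp z))).comp (measurable_roundShift x)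

/-- Random rounding preserves the `ℓ₁`-distance on average. Only the marginal law of the shift in
each coordinate matters, so that a shift common to all coordinates suffices. -/
theorem lintegral_enorm_roundZ_sub (x y : EllOne) :
    ∫⁻ u, ‖(roundZ x u - roundZ y u : EllOne)‖ₑ ∂uniformMeasure =
      ‖x - y‖ₑ := by
  simp only [EllOne.enorm_eq_tsum, lp.coeFn_sub, Pi.sub_apply, roundZ_apply]
  have hmeas (z : EllOne) (n : ℕ) : Measurable fun u : Ioo (0 : ℝ) 1 => (⌊z n + u⌋ : ℝ) :=
    measurable_from_top.comp (measurable_subtype_coe.const_add (z n)).floor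
  refine (lintegral_tsum fun n => ((hmeas x n).sub (hmeas y n)).enorm.aemeasurable).trans ?_
  refine tsum_congr fun n => ?_
  rw [← lintegral_enorm_floor_sub (x n) (y n), ← lintegral_subtype_comap measurableSet_Ioo]
  rfl

theorem lintegral_enorm_comp_roundZ_sub_le (f : Lip0 ZFin 0) (x y : EllOne) :
    ∫⁻ u, ‖f (roundZ x u) - f (roundZ y u)‖ₑ ∂uniformMeasure ≤
      ENNReal.ofReal ‖f‖ * ‖x - y‖ₑ := by
  rw [← lintegral_enorm_roundZ_sub, ← lintegral_const_mul' _ _ ENNReal.ofReal_ne_top]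
  refine lintegral_mono fun u => ?_
  rw [← ofReal_norm, ← ofReal_norm, ← ENNReal.ofReal_mul (norm_nonneg f)]
  refine ENNReal.ofReal_le_ofReal ?_
  simpa [Subtype.dist_eq, dist_eq_norm] using Lip0.abs_sub_le f (roundZ x u) (roundZ y u)

theorem roundZ_zero (u : Ioo (0 : ℝ) 1) : roundZ 0 u = 0 := roundZ_coe 0 u

theorem integrable_comp_roundZ (f : Lip0 ZFin 0) (x : EllOne) :
    Integrable (fun u => f (roundZ x u)) uniformMeasure := by
  refine ⟨(measurable_comp_roundZ f x).aestronglyMeasurable, ?_⟩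
  have h := lintegral_enorm_comp_roundZ_sub_le f x 0
  simp only [roundZ_zero, Lip0.map_base, sub_zero] at h
  exact h.trans_lt (ENNReal.mul_lt_top ENNReal.ofReal_lt_top enorm_lt_top)

/-- The expected value of `f` at the random rounding of `x`, as a functional of `f`. -/
def expectedValue (x : EllOne) : Lip0 ZFin 0 →ₗ[ℝ] ℝ where
  toFun f := ∫ u, f (roundZ x u) ∂uniformMeasure
  map_add' f g := integral_add (integrable_comp_roundZ f x) (integrable_comp_roundZ g x)
  map_smul' c f := integral_const_mul c fun u => f (roundZ x u)

theorem expectedValue_apply (x : EllOne) (f : Lip0 ZFin 0) :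
    expectedValue x f = ∫ u, f (roundZ x u) ∂uniformMeasure := rfl

theorem expectedValue_coe (z : ZFin) (f : Lip0 ZFin 0) : expectedValue z f = f z := by
  simp [expectedValue_apply, roundZ_coe]

theorem abs_expectedValue_sub_le (f : Lip0 ZFin 0) (x y : EllOne) :
    |expectedValue x f - expectedValue y f| ≤ ‖f‖ * ‖x - y‖ := by
  rw [expectedValue_apply, expectedValue_apply,
    ← integral_sub (integrable_comp_roundZ f x) (integrable_comp_roundZ f y),
    ← ENNReal.ofReal_le_ofReal_iff (by positivity), ← Real.norm_eq_abs,
    ofReal_norm, ENNReal.ofReal_mul (norm_nonneg f), ofReal_norm (x - y)]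
  exact (enorm_integral_le_lintegral_enorm _).trans (lintegral_enorm_comp_roundZ_sub_le f x y)

/-- The linear extension operator `Lip₀(ℤ^{<ℕ}) → Lip₀(ℓ₁)` of norm at most one, sending `f` to the
expected value of `f` at the random rounding of a point. -/
def Lip0.extend : Lip0 ZFin 0 →L[ℝ] Lip0 EllOne 0 :=
  Lip0.mkOperator expectedValue 1 zero_le_one
    (fun f => (expectedValue_coe 0 f).trans f.map_base)
    fun f x y => by
      rw [one_mul, dist_eq_norm]
      exact abs_expectedValue_sub_le f x y

theorem Lip0.norm_extend_le (f : Lip0 ZFin 0) : ‖Lip0.extend f‖ ≤ ‖f‖ :=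
  (Lip0.norm_mkOperator_le ..).trans_eq (one_mul _)

theorem Lip0.extend_coe (f : Lip0 ZFin 0) (z : ZFin) : Lip0.extend f z = f z :=
  expectedValue_coe z f

end Rounding

/-! ### `Lip₀(ℓ₁)` is complemented in `ℓ∞(Lip₀(ℤ^{<ℕ}))` -/

section Dilation

open Filter Topology BoundedSeq

/-- A nearest point to `x` in the lattice `2⁻ⁿ ℤ^{<ℕ}`: the shift `1 / 2` turns the floor into
rounding to the nearest integer. -/
def nearestDyadic (n : ℕ) (x : EllOne) : EllOne :=
  ((2 : ℝ) ^ n)⁻¹ • (roundZ ((2 : ℝ) ^ n • x) ⟨1 / 2, by norm_num, by norm_num⟩ : EllOne)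

theorem nearestDyadic_apply (n : ℕ) (x : EllOne) (k : ℕ) :
    nearestDyadic n x k = ((2 : ℝ) ^ n)⁻¹ * round ((2 : ℝ) ^ n * x k) := by
  rw [nearestDyadic, lp.coeFn_smul, Pi.smul_apply, roundZ_apply, lp.coeFn_smul, Pi.smul_apply,
    round_eq]
  rfl

theorem norm_sub_nearestDyadic_apply (n : ℕ) (x : EllOne) (k : ℕ) :
    ‖(x - nearestDyadic n x) k‖ =
      ((2 : ℝ) ^ n)⁻¹ * |(2 : ℝ) ^ n * x k - round ((2 : ℝ) ^ n * x k)| := by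
  have h2 : (0 : ℝ) < 2 ^ n := by positivity
  rw [lp.coeFn_sub, Pi.sub_apply, nearestDyadic_apply, Real.norm_eq_abs,
    ← abs_of_pos (inv_pos.2 h2), ← abs_mul, abs_of_pos (inv_pos.2 h2), mul_sub,
    inv_mul_cancel_left₀ h2.ne']

theorem tendsto_norm_sub_nearestDyadic (x : EllOne) :
    Tendsto (fun n => ‖x - nearestDyadic n x‖) atTop (𝓝 0) := by
  have h2 (n : ℕ) : (0 : ℝ) < 2 ^ n := by positivity
  -- Dominated convergence: the origin competes for the nearest lattice point, which bounds the
  -- `k`-th coordinate of the error by `|x k|`.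
  have key : Tendsto (fun n => ∑' k, ‖(x - nearestDyadic n x) k‖) atTop
      (𝓝 (∑' _ : ℕ, (0 : ℝ))) := by
    refine tendsto_tsum_of_dominated_convergence x.hasSum_norm.summable (fun k => ?_)
      (Eventually.of_forall fun n k => ?_)
    · refine squeeze_zero (fun n => norm_nonneg _) (fun n => ?_)
        (tendsto_pow_atTop_nhds_zero_of_lt_one (r := (2 : ℝ)⁻¹) (by norm_num) (by norm_num))
      rw [norm_sub_nearestDyadic_apply, inv_pow]
      exact mul_le_of_le_one_right (inv_pos.2 (h2 n)).le ((abs_sub_round _).trans (by norm_num))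
    · have h := round_le ((2 : ℝ) ^ n * x k) 0
      rw [Int.cast_zero, sub_zero, abs_mul, abs_of_pos (h2 n)] at h
      rw [norm_norm, norm_sub_nearestDyadic_apply, Real.norm_eq_abs]
      exact (inv_mul_le_iff₀ (h2 n)).2 h
  simpa only [(EllOne.hasSum_norm _).tsum_eq, tsum_zero] using key

/-- The operator `f ↦ c f(c⁻¹ ·)` from `Lip₀(ℓ₁)` to `Lip₀(ℤ^{<ℕ})`: restriction to the lattice
`c⁻¹ ℤ^{<ℕ}`, rescaled to a function on `ℤ^{<ℕ}`. -/
def restrictLattice (c : ℝ) (hc : c ≠ 0) : Lip0 EllOne 0 →L[ℝ] Lip0 ZFin 0 :=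
  Lip0.scaledComp (fun z : ZFin => c⁻¹ • (z : EllOne)) c (smul_zero _) fun x y => by
    rw [dist_smul₀, Real.norm_eq_abs, abs_inv, mul_inv_cancel_left₀ (abs_ne_zero.2 hc)]
    rfl

/-- The operator `f ↦ c⁻¹ f(c ·)` on `Lip₀(ℓ₁)`. -/
def dilate (c : ℝ) (hc : c ≠ 0) : Lip0 EllOne 0 →L[ℝ] Lip0 EllOne 0 :=
  Lip0.scaledComp (fun x : EllOne => c • x) c⁻¹ (smul_zero _) fun x y => by
    rw [dist_smul₀, Real.norm_eq_abs, abs_inv, inv_mul_cancel_left₀ (abs_ne_zero.2 hc)]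

theorem norm_restrictLattice_le (c : ℝ) (hc : c ≠ 0) (f : Lip0 EllOne 0) :
    ‖restrictLattice c hc f‖ ≤ 1 * ‖f‖ :=
  Lip0.norm_scaledComp_le ..

theorem norm_dilate_le (c : ℝ) (hc : c ≠ 0) (f : Lip0 EllOne 0) : ‖dilate c hc f‖ ≤ 1 * ‖f‖ :=
  Lip0.norm_scaledComp_le ..

theorem two_pow_ne_zero (n : ℕ) : (2 : ℝ) ^ n ≠ 0 := by positivity

/-- Restriction to the lattices `2⁻ⁿ ℤ^{<ℕ}`. -/
def restrictDyadic : Lip0 EllOne 0 →L[ℝ] Linf (Lip0 ZFin 0) :=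
  ofFamily (fun n => restrictLattice (2 ^ n) (two_pow_ne_zero n)) 1 zero_le_one fun _ f =>
    norm_restrictLattice_le _ _ f

/-- Extension of functions on the lattices `2⁻ⁿ ℤ^{<ℕ}` to `ℓ₁`. -/
def extendDyadic : Linf (Lip0 ZFin 0) →L[ℝ] Linf (Lip0 EllOne 0) :=
  ofFamily (fun n => dilate (2 ^ n) (two_pow_ne_zero n) ∘L Lip0.extend ∘L coord (Lip0 ZFin 0) n)
    1 zero_le_one fun n a => (norm_dilate_le _ (two_pow_ne_zero n) _).trans <| by
      gcongr
      exact (Lip0.norm_extend_le _).trans (norm_apply_le a n)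

theorem extendDyadic_apply (a : Linf (Lip0 ZFin 0)) (n : ℕ) (x : EllOne) :
    extendDyadic a n x = ((2 : ℝ) ^ n)⁻¹ * Lip0.extend (a n) ((2 : ℝ) ^ n • x) := rfl

theorem restrictDyadic_apply (f : Lip0 EllOne 0) (n : ℕ) (z : ZFin) :
    restrictDyadic f n z = (2 : ℝ) ^ n * f (((2 : ℝ) ^ n)⁻¹ • (z : EllOne)) := rfl

theorem extendDyadic_restrictDyadic_nearestDyadic (f : Lip0 EllOne 0) (n : ℕ) (x : EllOne) :
    extendDyadic (restrictDyadic f) n (nearestDyadic n x) = f (nearestDyadic n x) := by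
  rw [extendDyadic_apply, nearestDyadic, smul_inv_smul₀ (two_pow_ne_zero n), Lip0.extend_coe,
    restrictDyadic_apply, inv_mul_cancel_left₀ (two_pow_ne_zero n)]

theorem tendsto_extendDyadic_restrictDyadic (f : Lip0 EllOne 0) (x : EllOne) :
    Tendsto (fun n => extendDyadic (restrictDyadic f) n x) atTop (𝓝 (f x)) := by
  rw [tendsto_iff_norm_sub_tendsto_zero]
  set C := ‖extendDyadic (restrictDyadic f)‖
  have h : Tendsto (fun n => (C + ‖f‖) * ‖x - nearestDyadic n x‖) atTop (𝓝 0) := by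
    simpa using (tendsto_norm_sub_nearestDyadic x).const_mul (C + ‖f‖)
  refine squeeze_zero (fun n => norm_nonneg _) (fun n => ?_) h
  rw [Real.norm_eq_abs, ← dist_eq_norm, add_mul]
  have h₁ := Lip0.abs_sub_le (extendDyadic (restrictDyadic f) n) x (nearestDyadic n x)
  have h₂ := Lip0.abs_sub_le f (nearestDyadic n x) x
  rw [extendDyadic_restrictDyadic_nearestDyadic] at h₁
  rw [dist_comm] at h₂
  have h₃ : ‖extendDyadic (restrictDyadic f) n‖ * dist x (nearestDyadic n x) ≤
      C * dist x (nearestDyadic n x) := by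
    gcongr
    exact norm_apply_le _ n
  exact (_root_.abs_sub_le _ (f (nearestDyadic n x)) _).trans (add_le_add (h₁.trans h₃) h₂)

theorem ultralimit_extendDyadic_restrictDyadic (f : Lip0 EllOne 0) :
    Lip0.ultralimit (extendDyadic (restrictDyadic f)) = f :=
  Lip0.ext fun x => ultralimit_eq_of_tendsto (tendsto_extendDyadic_restrictDyadic f x)

end Dilation

/-! ### `ℓ∞(Lip₀(ℤ^{<ℕ}))` is complemented in `Lip₀(ℓ₁)` -/

section Blocks

open BoundedSeq

/-- The `n`-th component of `x` in the decomposition `ℓ₁ = ℓ₁(ℓ₁)` along `ℕ ≃ ℕ × ℕ`. -/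
def block (n : ℕ) (x : EllOne) : EllOne :=
  ⟨fun k => x (Nat.pair n k), memℓp_gen <| by
    have hinj : Function.Injective (Nat.pair n) := fun k l h => (Nat.pair_eq_pair.1 h).2
    simpa [Function.comp_def] using x.hasSum_norm.summable.comp_injective hinj⟩

@[simp] theorem block_apply (n : ℕ) (x : EllOne) (k : ℕ) : block n x k = x (Nat.pair n k) := rfl

theorem block_sub (n : ℕ) (x y : EllOne) : block n (x - y) = block n x - block n y := rfl

@[simp] theorem block_zero (n : ℕ) : block n 0 = 0 := rfl

theorem hasSum_norm_block (x : EllOne) : HasSum (fun n => ‖block n x‖) ‖x‖ :=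
  (Nat.pairEquiv.hasSum_iff.2 x.hasSum_norm).prod_fiberwise fun n => (block n x).hasSum_norm

/-- The isometric embedding of `ℓ₁` as the `n`-th summand of `ℓ₁ = ℓ₁(ℓ₁)`. -/
def blockIncl (n : ℕ) (x : EllOne) : EllOne :=
  ⟨fun m => if m.unpair.1 = n then x m.unpair.2 else 0, memℓp_gen <| by
    have hinj : Function.Injective (Nat.pair n) := fun k l h => (Nat.pair_eq_pair.1 h).2
    refine (hinj.summable_iff fun m hm => ?_).1 ?_
    · have : m.unpair.1 ≠ n := fun h => hm ⟨m.unpair.2, h ▸ Nat.pair_unpair m⟩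
      simp [this]
    · simpa [Function.comp_def] using x.hasSum_norm.summable⟩

theorem blockIncl_apply (n : ℕ) (x : EllOne) (m : ℕ) :
    blockIncl n x m = if m.unpair.1 = n then x m.unpair.2 else 0 := rfl

theorem blockIncl_sub (n : ℕ) (x y : EllOne) :
    blockIncl n (x - y) = blockIncl n x - blockIncl n y := by
  ext m
  rw [lp.coeFn_sub, Pi.sub_apply, blockIncl_apply, blockIncl_apply, blockIncl_apply]
  split_ifs <;> simp

theorem block_blockIncl_self (n : ℕ) (x : EllOne) : block n (blockIncl n x) = x := by
  ext k
  simp [blockIncl_apply]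

theorem block_blockIncl_of_ne {m n : ℕ} (h : m ≠ n) (x : EllOne) : block m (blockIncl n x) = 0 := by
  ext k
  simp [blockIncl_apply, h]

theorem norm_blockIncl (n : ℕ) (x : EllOne) : ‖blockIncl n x‖ = ‖x‖ := by
  rw [← (hasSum_norm_block (blockIncl n x)).tsum_eq, tsum_eq_single n, block_blockIncl_self]
  intro m hm
  rw [block_blockIncl_of_ne hm, norm_zero]

theorem abs_sub_block_le (a : Linf (Lip0 EllOne 0)) (x y : EllOne) (n : ℕ) :
    |a n (block n x) - a n (block n y)| ≤ ‖a‖ * ‖block n (x - y)‖ := by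
  rw [block_sub, ← dist_eq_norm]
  exact (Lip0.abs_sub_le _ _ _).trans (by gcongr; exact norm_apply_le a n)

theorem summable_glue (a : Linf (Lip0 EllOne 0)) (x : EllOne) :
    Summable fun n => a n (block n x) := by
  refine Summable.of_norm_bounded ((hasSum_norm_block x).summable.mul_left ‖a‖) fun n => ?_
  simpa using abs_sub_block_le a x 0 n

/-- The value at `x` of the function `x ↦ ∑ f n (block n x)` glued from a bounded sequence `f` in
`Lip₀(ℓ₁)`. -/
def glueAt (x : EllOne) : Linf (Lip0 EllOne 0) →ₗ[ℝ] ℝ where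
  toFun a := ∑' n, a n (block n x)
  map_add' a b := (summable_glue a x).tsum_add (summable_glue b x)
  map_smul' _ _ := tsum_mul_left

theorem glueAt_apply (x : EllOne) (a : Linf (Lip0 EllOne 0)) :
    glueAt x a = ∑' n, a n (block n x) := rfl

/-- The operator `ℓ∞(Lip₀(ℓ₁)) → Lip₀(ℓ₁)` sending `f` to `x ↦ ∑ f n (block n x)`. Its norm is at
most one since the distance in `ℓ₁ = ℓ₁(ℓ₁)` is the sum of the distances between the blocks. -/
def glue : Linf (Lip0 EllOne 0) →L[ℝ] Lip0 EllOne 0 :=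
  Lip0.mkOperator glueAt 1 zero_le_one (fun a => by simp [glueAt_apply]) fun a x y => by
    have hs := (hasSum_norm_block (x - y)).mul_left ‖a‖
    rw [glueAt_apply, glueAt_apply, ← (summable_glue a x).tsum_sub (summable_glue a y), one_mul,
      dist_eq_norm, ← Real.norm_eq_abs]
    exact tsum_of_norm_bounded hs fun n => abs_sub_block_le a x y n

theorem glue_blockIncl (a : Linf (Lip0 EllOne 0)) (n : ℕ) (x : EllOne) :
    glue a (blockIncl n x) = a n x := by
  change ∑' m, a m (block m (blockIncl n x)) = a n x
  rw [tsum_eq_single n, block_blockIncl_self]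
  intro m hm
  rw [block_blockIncl_of_ne hm, Lip0.map_base]

/-- Restriction of a function on `ℓ₁ = ℓ₁(ℓ₁)` to the lattice `ℤ^{<ℕ}` in each summand. -/
def restrictBlocks : Lip0 EllOne 0 →L[ℝ] Linf (Lip0 ZFin 0) :=
  ofFamily (fun n => Lip0.scaledComp (fun z : ZFin => blockIncl n z) 1
      (norm_eq_zero.1 ((norm_blockIncl n 0).trans norm_zero))
      fun x y => by
        rw [abs_one, one_mul, dist_eq_norm, ← blockIncl_sub, norm_blockIncl, ← dist_eq_norm]
        rfl)
    1 zero_le_one fun _ f => Lip0.norm_scaledComp_le _ _ _ _ f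

theorem restrictBlocks_glue_extend (a : Linf (Lip0 ZFin 0)) :
    restrictBlocks (glue (map Lip0.extend a)) = a := by
  ext n z
  change 1 * glue (map Lip0.extend a) (blockIncl n z) = a n z
  rw [one_mul, glue_blockIncl, map_apply, Lip0.extend_coe]

end Blocks

end

/-- The countable `ℓ∞`-sum of copies of `Lip₀(ℤ^{<ℕ})` is linearly isomorphic (by a bounded linear
bijection with bounded inverse) to `Lip₀(ℓ₁)`. Base points are the origins. -/
theorem mainTheorem10 :
    Nonempty (lp (fun _ : ℕ => Lip0 ZFin 0) ∞ ≃L[ℝ] Lip0 EllOne 0) :=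
  BoundedSeq.nonempty_equiv_of_retracts restrictDyadic (Lip0.ultralimit ∘L extendDyadic)
    ultralimit_extendDyadic_restrictDyadic (glue ∘L BoundedSeq.map Lip0.extend) restrictBlocks
    restrictBlocks_glue_extend
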